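/- Manifolds are smooth, finite-dimensional, Hausdorff, second countable and without boundary. For a manifold $M$, let $TM\oplus T^*M$ carry the pairing $\langle X+\alpha,Y+\beta\rangle_+=\tfrac12(\beta(X)+\alpha(Y))$ and the Courant bracket $$[\![X+\alpha,Y+\beta]\!]=[X,Y]+\mathcal L_X\beta-\mathcal L_Y\alpha+\tfrac12\,d(\alpha(Y)-\beta(X)).$$ A Dirac structure on $M$ is a smooth subbundle $L\subseteq TM\oplus T^*M$ whose fibres are maximally isotropic for $\langle\cdot,\cdot\rangle_+$ and whose space of smooth sections $\Gamma(L)$ is closed under the Courant bracket; $L$ is then a Lie algebroid over $M$ with the bracket $[\![\cdot,\cdot]\!]|_{\Gamma(L)}$ and the anchor $a_L(X+\alpha)=X$. Let $(M,L)$ and $(N,K)$ be manifolds with Dirac structures and let $\phi:M\to N$ be a smooth map. It is called an $f$-Dirac map if for all $x\in M$ $$K_{\phi(x)}=\{\phi_*X+\alpha : X\in T_xM,\ \alpha\in T^*_{\phi(x)}N,\ X+\phi^*\alpha\in L_x\},$$ and a $b$-Dirac map if for all $x\in M$ $$L_x=\{X+\phi^*\alpha : X\in T_xM,\ \alpha\in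 T^*_{\phi(x)}N,\ \phi_*X+\alpha\in K_{\phi(x)}\}.$$ **Proposition.** Suppose that $\phi:(M,L)\to(N,K)$ is an $f$-Dirac map and an immersion (its differential is injective at every point). Then $\phi$ is also a $b$-Dirac map. Moreover, $$\Psi:\phi^!K\to L,\qquad \Psi_x(Y+\beta)=(\phi_*)^{-1}Y+\phi^*\beta\qquad (x\in M,\ Y+\beta\in K_{\phi(x)}),$$ where $(\phi_*)^{-1}Y$ is the unique $X\in T_xM$ with $\phi_*X=Y$, is a well-defined smooth vector bundle map over $M$ from the pullback bundle $\phi^!K$ to $L$, and it is a Lie algebroid comorphism covering $\phi$: writing $\bar\Psi:\Gamma(K)\to\Gamma(L)$, $\bar\Psi(a)_x=\Psi_x(a_{\phi(x)})$, one has for all $a,b\in\Gamma(K)$ $$[\![\bar\Psi a,\bar\Psi b]\!]=\bar\Psi[\![a,b]\!],\qquad \phi_*\bigl(a_L(\bar\Psi a)_x\bigr)=a_K(a)_{\phi(x)}\quad (x\in M).$$ -/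

import Mathlib

open Set Bundle
open scoped Manifold ContDiff Topology

noncomputable section

namespace DiracGeom

section Basic

variable {E : Type*} [NormedAddCommGroup E] [NormedSpace ℝ E]
  {H : Type*} [TopologicalSpace H] (I : ModelWithCorners ℝ E H)
  {M : Type*} [TopologicalSpace M] [ChartedSpace H M]

/-- The cotangent space `T*_x M`. -/
abbrev Cotangent (x : M) : Type _ := TangentSpace I x →L[ℝ] Trivial M ℝ x

/-- The fibre `T_x M ⊕ T*_x M` of the generalized tangent bundle; the pair `(X, α)` stands for
`X + α`. -/
abbrev GenTangent (x : M) : Type _ := TangentSpace I x × Cotangent I x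

/-- The symmetric pairing `⟨X + α, Y + β⟩₊ = (β(X) + α(Y)) / 2`. -/
def pairing (x : M) (p q : GenTangent I x) : ℝ :=
  (1 / 2 : ℝ) * ((q.2 p.1 : ℝ) + (p.2 q.1 : ℝ))

/-- A subspace of `T_x M ⊕ T*_x M` is isotropic if the symmetric pairing vanishes on it. -/
def IsIsotropic (x : M) (W : Submodule ℝ (GenTangent I x)) : Prop :=
  ∀ p ∈ W, ∀ q ∈ W, pairing I x p q = 0

/-- A one-form `α` read in the preferred chart at `x₀`: the pullback of `α` by the inverse chart. -/
def formInChart (α : Π x : M, Cotangent I x) (x₀ : M) (u : E) : E →L[ℝ] ℝ :=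
  (α ((extChartAt I x₀).symm u)).comp
    (mfderivWithin 𝓘(ℝ, E) I (extChartAt I x₀).symm (range I) u)

/-- A vector field `X` read in the preferred chart at `x₀`. -/
def vectorInChart (X : Π x : M, TangentSpace I x) (x₀ : M) (u : E) : E :=
  VectorField.mpullbackWithin 𝓘(ℝ, E) I (extChartAt I x₀).symm X (range I) u

/-- The Lie derivative `L_X α` of a one-form along a vector field. In a chart it is
`v ↦ (D_X α)(v) + α(D_v X)`, that is `(L_X α)_j = X^i ∂_i α_j + α_i ∂_j X^i`. -/
def lieDerivForm (X : Π x : M, TangentSpace I x) (α : Π x : M, Cotangent I x) (x₀ : M) :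
    Cotangent I x₀ :=
  let u₀ : E := extChartAt I x₀ x₀
  let inChart : E →L[ℝ] ℝ :=
    fderivWithin ℝ (formInChart I α x₀) (range I) u₀ (vectorInChart I X x₀ u₀) +
      (formInChart I α x₀ u₀).comp (fderivWithin ℝ (vectorInChart I X x₀) (range I) u₀)
  inChart.comp (mfderiv I 𝓘(ℝ, E) (extChartAt I x₀) x₀)

/-- The differential `df` of a real function, as a one-form. -/
def dFun (f : M → ℝ) (x : M) : Cotangent I x := mfderiv I 𝓘(ℝ, ℝ) f x

/-- The Courant bracket
`⟦X + α, Y + β⟧ = [X, Y] + L_X β - L_Y α + (1/2) d(α(Y) - β(X))`. -/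
def courantBracket (a b : Π x : M, GenTangent I x) (x : M) : GenTangent I x :=
  (VectorField.mlieBracket I (fun y => (a y).1) (fun y => (b y).1) x,
    lieDerivForm I (fun y => (a y).1) (fun y => (b y).2) x
      - lieDerivForm I (fun y => (b y).1) (fun y => (a y).2) x
      + (1 / 2 : ℝ) • dFun I (fun y => ((a y).2 (b y).1 : ℝ) - ((b y).2 (a y).1 : ℝ)) x)

end Basic

section Dirac

variable {E : Type*} [NormedAddCommGroup E] [NormedSpace ℝ E]
  {H : Type*} [TopologicalSpace H] (I : ModelWithCorners ℝ E H)
  {M : Type*} [TopologicalSpace M] [ChartedSpace H M] [IsManifold I ∞ M]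
  {E' : Type*} [NormedAddCommGroup E'] [NormedSpace ℝ E']
  {H' : Type*} [TopologicalSpace H'] (J : ModelWithCorners ℝ E' H')
  {N : Type*} [TopologicalSpace N] [ChartedSpace H' N] [IsManifold J ∞ N]

/-- `s` is a smooth section over `U ⊆ M` of the pullback bundle `φ^!(TN ⊕ T*N)`: both components,
as maps to the total spaces of `TN` and `T*N`, are smooth on `U`. -/
def SmoothAlongOn (φ : M → N) (s : Π x : M, GenTangent J (φ x)) (U : Set M) : Prop :=
  ContMDiffOn I (J.prod 𝓘(ℝ, E')) ∞
      (fun x => (TotalSpace.mk' E' (φ x) (s x).1 : TotalSpace E' (TangentSpace J : N → Type _))) U ∧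
    ContMDiffOn I (J.prod 𝓘(ℝ, E' →L[ℝ] ℝ)) ∞
      (fun x => (TotalSpace.mk' (E' →L[ℝ] ℝ) (φ x) (s x).2 :
        TotalSpace (E' →L[ℝ] ℝ) (Cotangent J : N → Type _))) U

/-- `a` is a smooth section of `TM ⊕ T*M` over `U ⊆ M`. -/
def SmoothOn (a : Π x : M, GenTangent I x) (U : Set M) : Prop :=
  SmoothAlongOn I I (fun x : M => x) a U

/-- A family of subspaces of the fibres of `TM ⊕ T*M` is a (smooth) subbundle if near every point
it has a smooth frame. -/
def IsSubbundle (L : Π x : M, Submodule ℝ (GenTangent I x)) : Prop :=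
  ∀ x₀ : M, ∃ U : Set M, IsOpen U ∧ x₀ ∈ U ∧
    ∃ (k : ℕ) (e : Fin k → Π x : M, GenTangent I x),
      (∀ i, SmoothOn I (e i) U) ∧
      ∀ x ∈ U, LinearIndependent ℝ (fun i => e i x) ∧
        Submodule.span ℝ (range (fun i => e i x)) = L x

/-- The space `Γ(L)` of global smooth sections of a family of subspaces of `TM ⊕ T*M`. -/
def IsSectionOf (L : Π x : M, Submodule ℝ (GenTangent I x)) (a : Π x : M, GenTangent I x) : Prop :=
  SmoothOn I a univ ∧ ∀ x, a x ∈ L x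

/-- A Dirac structure on `M`: a maximally isotropic subbundle of `TM ⊕ T*M` whose space of sections
is closed under the Courant bracket. -/
structure DiracStructure (M : Type*) [TopologicalSpace M] [ChartedSpace H M]
    [IsManifold I ∞ M] where
  /-- the fibre `L_x ⊆ T_x M ⊕ T*_x M` -/
  fiber : Π x : M, Submodule ℝ (GenTangent I x)
  isSubbundle : IsSubbundle I fiber
  maximal_isotropic : ∀ x, Maximal (IsIsotropic I x) (fiber x)
  integrable : ∀ a b, IsSectionOf I fiber a → IsSectionOf I fiber b →
    IsSectionOf I fiber (courantBracket I a b)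

variable {I J}

namespace DiracStructure

/-- The space of sections `Γ(L)`. -/
def Sections (L : DiracStructure I M) : Type _ :=
  {a : Π x : M, GenTangent I x // IsSectionOf I L.fiber a}

/-- The value of a section of `L` at `x`, an element of `L_x`. -/
def Sections.eval {L : DiracStructure I M} (a : L.Sections) (x : M) : L.fiber x :=
  ⟨a.1 x, a.2.2 x⟩

/-- The bracket of the Lie algebroid `L`: the restriction of the Courant bracket to `Γ(L)`. -/
def bracket (L : DiracStructure I M) (a b : L.Sections) : L.Sections :=
  ⟨courantBracket I a.1 b.1, L.integrable a.1 b.1 a.2 b.2⟩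

/-- The anchor of the Lie algebroid `L`: the restriction to `L` of the projection to `TM`. -/
def anchor (L : DiracStructure I M) (x : M) (p : L.fiber x) : TangentSpace I x := p.1.1

end DiracStructure

/-- The fibre over `x` of the backward image
`B_φ(K) = {X + φ^*α : φ_* X + α ∈ K_{φ(x)}}`. -/
def backwardImage (φ : M → N) (K : DiracStructure J N) (x : M) : Set (GenTangent I x) :=
  {p | ∃ (X : TangentSpace I x) (α : Cotangent J (φ x)),
    (mfderiv I J φ x X, α) ∈ K.fiber (φ x) ∧ p = (X, α.comp (mfderiv I J φ x))}

/-- The fibre over `x` of the forward image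
`F_φ(L) = {φ_* X + α : X + φ^*α ∈ L_x}`, a subset of `T_{φ(x)} N ⊕ T*_{φ(x)} N`. -/
def forwardImage (φ : M → N) (L : DiracStructure I M) (x : M) : Set (GenTangent J (φ x)) :=
  {q | ∃ (X : TangentSpace I x) (α : Cotangent J (φ x)),
    (X, α.comp (mfderiv I J φ x)) ∈ L.fiber x ∧ q = (mfderiv I J φ x X, α)}

/-- `φ : (M, L) → (N, K)` is a `b`-Dirac (backward Dirac) map: `L = B_φ(K)`. -/
def IsBDirac (φ : M → N) (L : DiracStructure I M) (K : DiracStructure J N) : Prop :=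
  ContMDiff I J ∞ φ ∧ ∀ x, (L.fiber x : Set (GenTangent I x)) = backwardImage φ K x

/-- `φ : (M, L) → (N, K)` is an `f`-Dirac (forward Dirac) map: `φ^! K = F_φ(L)`. -/
def IsFDirac (φ : M → N) (L : DiracStructure I M) (K : DiracStructure J N) : Prop :=
  ContMDiff I J ∞ φ ∧ ∀ x, (K.fiber (φ x) : Set (GenTangent J (φ x))) = forwardImage φ L x

/-- `φ` is an immersion: it is smooth and its differential is injective at every point. -/
def IsSmoothImmersion (I : ModelWithCorners ℝ E H) (J : ModelWithCorners ℝ E' H')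
    (φ : M → N) : Prop :=
  ContMDiff I J ∞ φ ∧ ∀ x, Function.Injective (mfderiv I J φ x)

/-- A (smooth) vector bundle map `Φ : φ^! K → L` over the identity of `M`: a family of linear maps
`K_{φ(x)} → L_x` carrying smooth local sections of `φ^! K` to smooth local sections of `L`. -/
structure PullbackBundleMap (φ : M → N) (L : DiracStructure I M) (K : DiracStructure J N) where
  toFun : Π x : M, K.fiber (φ x) →ₗ[ℝ] L.fiber x
  smooth : ∀ U : Set M, IsOpen U → ∀ s : (Π x : M, K.fiber (φ x)),
    SmoothAlongOn I J φ (fun x => (s x).1) U → SmoothOn I (fun x => (toFun x (s x)).1) U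

/-- If `a` is a smooth section of `TN ⊕ T*N`, then `a ∘ φ` is a smooth section of its pullback. -/
theorem SmoothOn.comp_along {φ : M → N} (hφ : ContMDiff I J ∞ φ) {a : Π y : N, GenTangent J y}
    (ha : SmoothOn J a univ) : SmoothAlongOn I J φ (fun x => a (φ x)) univ :=
  ⟨ha.1.comp hφ.contMDiffOn (fun _ _ => mem_univ _),
    ha.2.comp hφ.contMDiffOn (fun _ _ => mem_univ _)⟩

/-- The map `Γ(K) → Γ(L)`, `a ↦ Φ(a ∘ φ)`, induced by a bundle map `Φ : φ^! K → L`. -/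
def PullbackBundleMap.onSections {φ : M → N} {L : DiracStructure I M} {K : DiracStructure J N}
    (Φ : PullbackBundleMap φ L K) (hφ : ContMDiff I J ∞ φ) (a : K.Sections) : L.Sections :=
  ⟨fun x => (Φ.toFun x (a.eval (φ x))).1,
    Φ.smooth univ isOpen_univ (fun x => a.eval (φ x)) (a.2.1.comp_along hφ),
    fun x => (Φ.toFun x (a.eval (φ x))).2⟩

/-- `Φ : φ^! K → L` is a Lie algebroid comorphism covering `φ`: the induced map of sections
preserves brackets and is compatible with the anchors, `φ_* (a_L (Φ a)) = a_K (a)` along `φ`. -/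
structure PullbackBundleMap.IsComorphism {φ : M → N} {L : DiracStructure I M}
    {K : DiracStructure J N} (Φ : PullbackBundleMap φ L K) (hφ : ContMDiff I J ∞ φ) : Prop where
  bracket : ∀ a b : K.Sections,
    L.bracket (Φ.onSections hφ a) (Φ.onSections hφ b) = Φ.onSections hφ (K.bracket a b)
  anchor : ∀ (a : K.Sections) (x : M),
    mfderiv I J φ x (L.anchor x ((Φ.onSections hφ a).eval x)) = K.anchor (φ x) (a.eval (φ x))

end Dirac

end DiracGeom

end

namespace DiracGeom

set_option linter.unusedSectionVars false

/-! Call sections `a` over `M` and `a'` over `N` related when `φ_*` carries the vector part of `a`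
to that of `a'` along `φ`, and the form part of `a` is the pullback of that of `a'`.

Pointwise, a left inverse `P` of `φ_*` writes every covector `ξ` at `x` as the pullback of `ξ ∘ P`,
and injectivity makes the vector upstairs unique. Hence the forward relation can be read backwards
(`IsFDirac.isBDirac`), and each element of `K` is related to exactly one element of `L`, which
defines `Ψ` (`IsFDirac.exists_pullback`).

`Ψ` is smooth because a vector field is smooth once its image under a smooth family of injective
maps is (`contMDiffAt_of_mfderiv_apply`).

The Courant bracket respects relatedness (`courantBracket_of_related`): in charts, the Lie bracket
and Lie derivative produce second derivatives of `φ` that cancel by symmetry. So `⟦Ψa, Ψb⟧` and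
`Ψ⟦a, b⟧` are both related to `⟦a, b⟧`, and injectivity makes them equal. -/

theorem contMDiffAt_of_injective_clm_apply
    {E : Type*} [NormedAddCommGroup E] [NormedSpace ℝ E] [FiniteDimensional ℝ E]
    {E' : Type*} [NormedAddCommGroup E'] [NormedSpace ℝ E'] [FiniteDimensional ℝ E']
    {F : Type*} [NormedAddCommGroup F] [NormedSpace ℝ F]
    {H : Type*} [TopologicalSpace H] {I : ModelWithCorners ℝ F H}
    {M : Type*} [TopologicalSpace M] [ChartedSpace H M] {n : WithTop ℕ∞}
    {A : M → E →L[ℝ] E'} {X : M → E} {x₀ : M}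
    (hA : ContMDiffAt I 𝓘(ℝ, E →L[ℝ] E') n A x₀) (hinj : Function.Injective (A x₀))
    (hAX : ContMDiffAt I 𝓘(ℝ, E') n (fun x => A x (X x)) x₀) :
    ContMDiffAt I 𝓘(ℝ, E) n X x₀ := by
  -- With `P` fixed, `P ∘ A x` is the identity at `x₀`, hence invertible nearby with smooth inverse,
  -- and there `X = (P ∘ A)⁻¹ P (A X)`.
  obtain ⟨P₀, hP₀⟩ := (A x₀).toLinearMap.exists_leftInverse_of_injective
    (LinearMap.ker_eq_bot.2 hinj)
  let P : E' →L[ℝ] E := LinearMap.toContinuousLinearMap P₀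
  have hP : P.comp (A x₀) = ContinuousLinearMap.id ℝ E := by
    ext v
    exact LinearMap.congr_fun hP₀ v
  have hB : ContMDiffAt I 𝓘(ℝ, E →L[ℝ] E) n (fun x => P.comp (A x)) x₀ :=
    contMDiffAt_const.clm_comp hA
  have hinv : ContMDiffAt I 𝓘(ℝ, E →L[ℝ] E) n
      (fun x => ContinuousLinearMap.inverse (P.comp (A x))) x₀ := by
    have h := contDiffAt_map_inverse (𝕜 := ℝ) (n := n) (ContinuousLinearEquiv.refl ℝ E)
    refine ContMDiffAt.comp (I' := 𝓘(ℝ, E →L[ℝ] E)) x₀ (g := ContinuousLinearMap.inverse) ?_ hB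
    rw [hP]
    exact h.contMDiffAt
  have hev : ∀ᶠ x in 𝓝 x₀,
      X x = ContinuousLinearMap.inverse (P.comp (A x)) (P (A x (X x))) := by
    have hn : range ((↑) : (E ≃L[ℝ] E) → E →L[ℝ] E) ∈ 𝓝 (P.comp (A x₀)) := by
      rw [hP]
      exact ContinuousLinearEquiv.nhds (ContinuousLinearEquiv.refl ℝ E)
    filter_upwards [hB.continuousAt hn] with x ⟨e, he⟩
    have he' : (e : E →L[ℝ] E) = P.comp (A x) := he
    have h2 : P (A x (X x)) = e (X x) := by
      change (P.comp (A x)) (X x) = _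
      rw [← he']; rfl
    rw [h2, ← he', ContinuousLinearMap.inverse_equiv]
    simp
  exact (hinv.clm_apply (contMDiffAt_const.clm_apply hAX)).congr_of_eventuallyEq hev

/-! ### Related fields and forms on normed spaces -/

section Flat

variable {E : Type*} [NormedAddCommGroup E] [NormedSpace ℝ E]
    {E' : Type*} [NormedAddCommGroup E'] [NormedSpace ℝ E'] {f : E → E'} {u₀ : E}

/-- Differentiate `Df(X) = Y ∘ f` along `v`; the product rule leaves the Hessian term `D²f(v, X)`.
-/
theorem fderiv_apply_of_related {X : E → E} {Y : E' → E'}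
    (hf : ContDiffAt ℝ 2 f u₀) (hX : DifferentiableAt ℝ X u₀) (hY : DifferentiableAt ℝ Y (f u₀))
    (h : ∀ᶠ u in 𝓝 u₀, fderiv ℝ f u (X u) = Y (f u)) (v : E) :
    fderiv ℝ f u₀ (fderiv ℝ X u₀ v) =
      fderiv ℝ Y (f u₀) (fderiv ℝ f u₀ v) - fderiv ℝ (fderiv ℝ f) u₀ v (X u₀) := by
  have hdf : DifferentiableAt ℝ (fderiv ℝ f) u₀ :=
    (hf.fderiv_right (m := 1) (by norm_num)).differentiableAt one_ne_zero
  have h1 := (hdf.hasFDerivAt.clm_apply hX.hasFDerivAt).congr_of_eventuallyEq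
    (f₁ := fun u => Y (f u)) (h.mono fun u hu => hu.symm)
  have h2 := hY.hasFDerivAt.comp u₀ (hf.differentiableAt two_ne_zero).hasFDerivAt
  have h3 := DFunLike.congr_fun (h1.unique h2) v
  simp only [add_apply, ContinuousLinearMap.comp_apply,
    ContinuousLinearMap.flip_apply] at h3
  rw [← h3]
  abel

/-- The Hessian terms of the two halves of the bracket are `D²f(X₁, X₂)` and `D²f(X₂, X₁)`, which
cancel by symmetry. -/
theorem fderiv_lieBracket_of_related {X₁ X₂ : E → E} {Y₁ Y₂ : E' → E'}
    (hf : ContDiffAt ℝ 2 f u₀)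
    (hX₁ : DifferentiableAt ℝ X₁ u₀) (hY₁ : DifferentiableAt ℝ Y₁ (f u₀))
    (hX₂ : DifferentiableAt ℝ X₂ u₀) (hY₂ : DifferentiableAt ℝ Y₂ (f u₀))
    (h₁ : ∀ᶠ u in 𝓝 u₀, fderiv ℝ f u (X₁ u) = Y₁ (f u))
    (h₂ : ∀ᶠ u in 𝓝 u₀, fderiv ℝ f u (X₂ u) = Y₂ (f u)) :
    fderiv ℝ f u₀ (VectorField.lieBracket ℝ X₁ X₂ u₀) =
      VectorField.lieBracket ℝ Y₁ Y₂ (f u₀) := by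
  have hs : IsSymmSndFDerivAt ℝ f u₀ := hf.isSymmSndFDerivAt (by simp)
  rw [VectorField.lieBracket, map_sub, fderiv_apply_of_related hf hX₁ hY₁ h₁,
    fderiv_apply_of_related hf hX₂ hY₂ h₂, h₁.self_of_nhds, h₂.self_of_nhds,
    hs.eq (X₁ u₀) (X₂ u₀), VectorField.lieBracket]
  abel

/-- Differentiating `α = (β ∘ f) Df` along `X` gives `β(D²f(X, v))`, and `α(D_v X)` contributes
`-β(D²f(v, X))`; symmetry cancels them. -/
theorem fderiv_lieDeriv_of_related {X : E → E} {Y : E' → E'}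
    {α : E → E →L[ℝ] ℝ} {β : E' → E' →L[ℝ] ℝ}
    (hf : ContDiffAt ℝ 2 f u₀) (hX : DifferentiableAt ℝ X u₀)
    (hY : DifferentiableAt ℝ Y (f u₀)) (hβ : DifferentiableAt ℝ β (f u₀))
    (h : ∀ᶠ u in 𝓝 u₀, fderiv ℝ f u (X u) = Y (f u))
    (hα : ∀ᶠ u in 𝓝 u₀, α u = (β (f u)).comp (fderiv ℝ f u)) :
    fderiv ℝ α u₀ (X u₀) + (α u₀).comp (fderiv ℝ X u₀) =
      (fderiv ℝ β (f u₀) (Y (f u₀)) + (β (f u₀)).comp (fderiv ℝ Y (f u₀))).comp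
        (fderiv ℝ f u₀) := by
  have hdf : DifferentiableAt ℝ (fderiv ℝ f) u₀ :=
    (hf.fderiv_right (m := 1) (by norm_num)).differentiableAt one_ne_zero
  have hs : IsSymmSndFDerivAt ℝ f u₀ := hf.isSymmSndFDerivAt (by simp)
  have h1 := ((hβ.hasFDerivAt.comp u₀
    (hf.differentiableAt two_ne_zero).hasFDerivAt).clm_comp hdf.hasFDerivAt).congr_of_eventuallyEq
    (f₁ := α) hα
  ext v
  rw [h1.fderiv, hα.self_of_nhds]
  have h2 := fderiv_apply_of_related hf hX hY h v
  have h3 := hs.eq v (X u₀)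
  simp [h2, h3, h.self_of_nhds]
  abel

end Flat

/-! ### Smoothness of pulled-back forms and of lifted vectors -/

section Smooth

variable
    {E : Type*} [NormedAddCommGroup E] [NormedSpace ℝ E]
    {H : Type*} [TopologicalSpace H] {I : ModelWithCorners ℝ E H}
    {M : Type*} [TopologicalSpace M] [ChartedSpace H M] [IsManifold I ∞ M]
    {E' : Type*} [NormedAddCommGroup E'] [NormedSpace ℝ E']
    {H' : Type*} [TopologicalSpace H'] {J : ModelWithCorners ℝ E' H'}
    {N : Type*} [TopologicalSpace N] [ChartedSpace H' N] [IsManifold J ∞ N]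

theorem inCoordinates_cotangent (x₀ x : M) (α : Cotangent I x) :
    ContinuousLinearMap.inCoordinates E (TangentSpace I : M → Type _) ℝ (Trivial M ℝ) x₀ x x₀ x α =
      α.comp ((trivializationAt E (TangentSpace I : M → Type _) x₀).symmL ℝ x) := by
  ext v
  simp [ContinuousLinearMap.inCoordinates]

theorem contMDiffAt_mfderiv_inCoordinates {φ : M → N} (hφ : ContMDiff I J ∞ φ) (x₀ : M) :
    ContMDiffAt I 𝓘(ℝ, E →L[ℝ] E') ∞
      (fun x => ContinuousLinearMap.inCoordinates E (TangentSpace I : M → Type _) E'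
        (TangentSpace J : N → Type _) x₀ x (φ x₀) (φ x) (mfderiv I J φ x)) x₀ :=
  (hφ x₀).mfderiv_const (m := ∞) (by simp)

/-- In bundle coordinates the pullback is the composite of the coordinate forms of `β` and `φ_*`;
the trivialization of `TN` cancels in the middle wherever `φ x` stays in its base set. -/
theorem contMDiffAt_cotangent_comp_mfderiv {φ : M → N} (hφ : ContMDiff I J ∞ φ)
    {β : Π x : M, Cotangent J (φ x)} {x₀ : M}
    (hβ : ContMDiffAt I (J.prod 𝓘(ℝ, E' →L[ℝ] ℝ)) ∞
      (fun x => (TotalSpace.mk' (E' →L[ℝ] ℝ) (φ x) (β x) :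
        TotalSpace (E' →L[ℝ] ℝ) (Cotangent J : N → Type _))) x₀) :
    ContMDiffAt I (I.prod 𝓘(ℝ, E →L[ℝ] ℝ)) ∞
      (fun x => (TotalSpace.mk' (E →L[ℝ] ℝ) x ((β x).comp (mfderiv I J φ x)) :
        TotalSpace (E →L[ℝ] ℝ) (Cotangent I : M → Type _))) x₀ := by
  rw [contMDiffAt_hom_bundle] at hβ ⊢
  refine ⟨contMDiffAt_id, ?_⟩
  refine (hβ.2.clm_comp (contMDiffAt_mfderiv_inCoordinates hφ x₀)).congr_of_eventuallyEq ?_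
  have h := (hφ.continuous.continuousAt (x := x₀)).preimage_mem_nhds
    ((trivializationAt E' (TangentSpace J : N → Type _) (φ x₀)).open_baseSet.mem_nhds
      (mem_baseSet_trivializationAt E' (TangentSpace J : N → Type _) (φ x₀)))
  filter_upwards [h] with x hx
  simp only [inCoordinates_cotangent]
  ext v
  simp only [ContinuousLinearMap.comp_apply, ContinuousLinearMap.inCoordinates]
  rw [Trivialization.symmL_continuousLinearMapAt _ hx]

variable [FiniteDimensional ℝ E] [FiniteDimensional ℝ E']

/-- In trivializations `φ_*` is a smooth operator family, injective at `x₀`, so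
`contMDiffAt_of_injective_clm_apply` recovers `X`. -/
theorem contMDiffAt_of_mfderiv_apply {φ : M → N} (hφ : ContMDiff I J ∞ φ)
    {X : Π x : M, TangentSpace I x} {x₀ : M} (hinj : Function.Injective (mfderiv I J φ x₀))
    (hX : ContMDiffAt I (J.prod 𝓘(ℝ, E')) ∞
      (fun x => (TotalSpace.mk' E' (φ x) (mfderiv I J φ x (X x)) :
        TotalSpace E' (TangentSpace J : N → Type _))) x₀) :
    ContMDiffAt I (I.prod 𝓘(ℝ, E)) ∞
      (fun x => (TotalSpace.mk' E x (X x) : TotalSpace E (TangentSpace I : M → Type _))) x₀ := by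
  rw [contMDiffAt_totalSpace] at hX ⊢
  refine ⟨contMDiffAt_id, ?_⟩
  have hb := mem_baseSet_trivializationAt E (TangentSpace I : M → Type _) x₀
  have hb' := mem_baseSet_trivializationAt E' (TangentSpace J : N → Type _) (φ x₀)
  refine contMDiffAt_of_injective_clm_apply (contMDiffAt_mfderiv_inCoordinates hφ x₀) ?_ ?_
  · rw [ContinuousLinearMap.inCoordinates_eq hb hb']
    exact (((trivializationAt E' (TangentSpace J : N → Type _) (φ x₀)).continuousLinearEquivAt
      ℝ (φ x₀) hb').injective.comp hinj).comp
      ((trivializationAt E (TangentSpace I : M → Type _) x₀).continuousLinearEquivAt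
        ℝ x₀ hb).symm.injective
  · refine hX.2.congr_of_eventuallyEq ?_
    have h := (hφ.continuous.continuousAt (x := x₀)).preimage_mem_nhds
      ((trivializationAt E' (TangentSpace J : N → Type _) (φ x₀)).open_baseSet.mem_nhds hb')
    filter_upwards [h, (trivializationAt E (TangentSpace I : M → Type _) x₀).open_baseSet.mem_nhds
      hb] with x hx' hx
    rw [ContinuousLinearMap.inCoordinates_eq hx hx']
    simp [(trivializationAt E (TangentSpace I : M → Type _) x₀).symm_apply_apply_mk hx]

end Smooth

/-! ### Transfer of relatedness to charts and back -/

section Charts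

variable
    {E : Type*} [NormedAddCommGroup E] [NormedSpace ℝ E]
    {H : Type*} [TopologicalSpace H] {I : ModelWithCorners ℝ E H} [I.Boundaryless]
    {M : Type*} [TopologicalSpace M] [ChartedSpace H M] [IsManifold I ∞ M]
    {E' : Type*} [NormedAddCommGroup E'] [NormedSpace ℝ E']
    {H' : Type*} [TopologicalSpace H'] {J : ModelWithCorners ℝ E' H'} [J.Boundaryless]
    {N : Type*} [TopologicalSpace N] [ChartedSpace H' N] [IsManifold J ∞ N]

theorem contDiffAt_writtenInExtChartAt {φ : M → N} (hφ : ContMDiff I J ∞ φ) (x₀ : M) :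
    ContDiffAt ℝ ∞ (writtenInExtChartAt I J x₀ φ) (extChartAt I x₀ x₀) := by
  have h := (contMDiffAt_iff.1 (hφ x₀)).2
  rwa [I.range_eq_univ, contDiffWithinAt_univ] at h

theorem eventually_mem_source {φ : M → N} (hφ : ContMDiff I J ∞ φ) (x₀ : M) :
    ∀ᶠ u in 𝓝 (extChartAt I x₀ x₀),
      φ ((extChartAt I x₀).symm u) ∈ (extChartAt J (φ x₀)).source := by
  have h1 : ContinuousAt (fun u => φ ((extChartAt I x₀).symm u)) (extChartAt I x₀ x₀) :=
    hφ.continuous.continuousAt.comp (continuousAt_extChartAt_symm x₀)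
  refine h1.preimage_mem_nhds ?_
  rw [extChartAt_to_inv]
  exact extChartAt_source_mem_nhds (φ x₀)

theorem eventually_extChartAt_symm_writtenInExtChartAt {φ : M → N} (hφ : ContMDiff I J ∞ φ)
    (x₀ : M) :
    ∀ᶠ u in 𝓝 (extChartAt I x₀ x₀),
      (extChartAt J (φ x₀)).symm (writtenInExtChartAt I J x₀ φ u) =
        φ ((extChartAt I x₀).symm u) := by
  filter_upwards [eventually_mem_source hφ x₀] with u hu
  exact (extChartAt J (φ x₀)).left_inv hu

/-- This is the chain rule for the two expressions of `φ` composed with the inverse chart. It is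
needed on a neighbourhood because the flat lemmas differentiate the relation. -/
theorem eventually_mfderiv_comp_symm {φ : M → N} (hφ : ContMDiff I J ∞ φ) (x₀ : M) :
    ∀ᶠ u in 𝓝 (extChartAt I x₀ x₀), ∀ v : E,
      (mfderiv I J φ ((extChartAt I x₀).symm u)
        (mfderivWithin 𝓘(ℝ, E) I (extChartAt I x₀).symm (range I) u v) : E') =
      mfderivWithin 𝓘(ℝ, E') J (extChartAt J (φ x₀)).symm (range J)
        (writtenInExtChartAt I J x₀ φ u)
        (fderiv ℝ (writtenInExtChartAt I J x₀ φ) u v) := by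
  filter_upwards [eventually_mem_source hφ x₀,
    -- Equality at `u` alone would not suffice: derivatives at `u` are compared, so it must hold
    -- near `u`.
    (eventually_extChartAt_symm_writtenInExtChartAt hφ x₀).eventually_nhds,
    extChartAt_target_mem_nhds (I := I) x₀,
    ((contDiffAt_writtenInExtChartAt hφ x₀).of_le (m := 1) (by simp)).eventually (by simp)]
    with u hs he ht hf v
  have h1 : MDifferentiableAt 𝓘(ℝ, E) I (extChartAt I x₀).symm u := by
    have := mdifferentiableWithinAt_extChartAt_symm (I := I) ht
    rwa [I.range_eq_univ, mdifferentiableWithinAt_univ] at this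
  have h2 : MDifferentiableAt 𝓘(ℝ, E') J (extChartAt J (φ x₀)).symm
      (writtenInExtChartAt I J x₀ φ u) := by
    have := mdifferentiableWithinAt_extChartAt_symm (I := J)
      ((extChartAt J (φ x₀)).map_source hs)
    rwa [J.range_eq_univ, mdifferentiableWithinAt_univ] at this
  have h3 : MDifferentiableAt 𝓘(ℝ, E) 𝓘(ℝ, E') (writtenInExtChartAt I J x₀ φ) u :=
    (hf.differentiableAt one_ne_zero).mdifferentiableAt
  have hφ' : MDifferentiableAt I J φ ((extChartAt I x₀).symm u) :=
    (hφ _).mdifferentiableAt (by simp)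
  rw [I.range_eq_univ, J.range_eq_univ, mfderivWithin_univ, mfderivWithin_univ]
  have h4 := mfderiv_comp u hφ' h1
  have h5 := mfderiv_comp u h2 h3
  have h6 : mfderiv 𝓘(ℝ, E) J ((extChartAt J (φ x₀)).symm ∘ writtenInExtChartAt I J x₀ φ) u =
      mfderiv 𝓘(ℝ, E) J (φ ∘ (extChartAt I x₀).symm) u :=
    Filter.EventuallyEq.mfderiv_eq he
  rw [mfderiv_eq_fderiv] at h5
  exact DFunLike.congr_fun (h4.symm.trans (h6.symm.trans h5)) v

theorem eventually_formInChart_of_related {φ : M → N} (hφ : ContMDiff I J ∞ φ) (x₀ : M)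
    {α : Π x : M, Cotangent I x} {β : Π y : N, Cotangent J y}
    (h : ∀ x, α x = (β (φ x)).comp (mfderiv I J φ x)) :
    ∀ᶠ u in 𝓝 (extChartAt I x₀ x₀),
      formInChart I α x₀ u =
        (formInChart J β (φ x₀) (writtenInExtChartAt I J x₀ φ u)).comp
          (fderiv ℝ (writtenInExtChartAt I J x₀ φ) u) := by
  filter_upwards [eventually_mfderiv_comp_symm hφ x₀,
    eventually_extChartAt_symm_writtenInExtChartAt hφ x₀] with u hu he
  ext v
  have h1 := hu v
  simp only [formInChart, h]
  change (β (φ ((extChartAt I x₀).symm u)) : E' →L[ℝ] ℝ) _ =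
    (β ((extChartAt J (φ x₀)).symm (writtenInExtChartAt I J x₀ φ u)) : E' →L[ℝ] ℝ) _
  -- The two values of `β` lie in fibres over points only propositionally equal, so they are
  -- compared in the model space `E' →L[ℝ] ℝ`.
  have h2 : (β ((extChartAt J (φ x₀)).symm (writtenInExtChartAt I J x₀ φ u)) : E' →L[ℝ] ℝ) =
      β (φ ((extChartAt I x₀).symm u)) := by rw [he]
  rw [h2]
  exact congrArg (β (φ ((extChartAt I x₀).symm u)) : E' →L[ℝ] ℝ) h1

theorem mfderivWithin_symm_vectorInChart (X : Π x : M, TangentSpace I x) {x₀ : M} {u : E}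
    (hu : u ∈ (extChartAt I x₀).target) :
    mfderivWithin 𝓘(ℝ, E) I (extChartAt I x₀).symm (range I) u
        (vectorInChart (E := E) I X x₀ u) =
      X ((extChartAt I x₀).symm u) :=
  (isInvertible_mfderivWithin_extChartAt_symm hu).self_apply_inverse _

theorem eventually_vectorInChart_of_related {φ : M → N} (hφ : ContMDiff I J ∞ φ) (x₀ : M)
    {X : Π x : M, TangentSpace I x} {Y : Π y : N, TangentSpace J y}
    (h : ∀ x, mfderiv I J φ x (X x) = Y (φ x)) :
    ∀ᶠ u in 𝓝 (extChartAt I x₀ x₀),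
      fderiv ℝ (writtenInExtChartAt I J x₀ φ) u (vectorInChart I X x₀ u) =
        vectorInChart J Y (φ x₀) (writtenInExtChartAt I J x₀ φ u) := by
  filter_upwards [eventually_mfderiv_comp_symm hφ x₀, eventually_mem_source hφ x₀,
    eventually_extChartAt_symm_writtenInExtChartAt hφ x₀,
    extChartAt_target_mem_nhds (I := I) x₀] with u hu hs he ht
  have ht' : writtenInExtChartAt I J x₀ φ u ∈ (extChartAt J (φ x₀)).target :=
    (extChartAt J (φ x₀)).map_source hs
  -- Pushing forward by the inverse chart of `N` is injective and turns the claim into relatedness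
  -- on the manifolds.
  apply (isInvertible_mfderivWithin_extChartAt_symm (I := J) ht').injective
  rw [mfderivWithin_symm_vectorInChart Y ht']
  refine (hu _).symm.trans ?_
  rw [mfderivWithin_symm_vectorInChart X ht, h]
  rw [he]

theorem fderiv_writtenInExtChartAt_mfderiv {φ : M → N} (hφ : ContMDiff I J ∞ φ) (x₀ : M)
    (v : TangentSpace I x₀) :
    fderiv ℝ (writtenInExtChartAt I J x₀ φ) (extChartAt I x₀ x₀)
        (mfderiv I 𝓘(ℝ, E) (extChartAt I x₀) x₀ v) =
      mfderiv J 𝓘(ℝ, E') (extChartAt J (φ x₀)) (φ x₀) (mfderiv I J φ x₀ v) := by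
  have hφ' : MDifferentiableAt I J φ x₀ := (hφ _).mdifferentiableAt (by simp)
  have h1 : MDifferentiableAt J 𝓘(ℝ, E') (extChartAt J (φ x₀)) (φ x₀) :=
    mdifferentiableAt_extChartAt (mem_chart_source H' (φ x₀))
  have h2 : MDifferentiableAt I 𝓘(ℝ, E) (extChartAt I x₀) x₀ :=
    mdifferentiableAt_extChartAt (mem_chart_source H x₀)
  have h3 : MDifferentiableAt 𝓘(ℝ, E) 𝓘(ℝ, E') (writtenInExtChartAt I J x₀ φ)
      (extChartAt I x₀ x₀) :=
    ((contDiffAt_writtenInExtChartAt hφ x₀).differentiableAt (by simp)).mdifferentiableAt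
  have h4 := mfderiv_comp x₀ h1 hφ'
  have h5 := mfderiv_comp x₀ h3 h2
  have h6 : mfderiv I 𝓘(ℝ, E') (writtenInExtChartAt I J x₀ φ ∘ extChartAt I x₀) x₀ =
      mfderiv I 𝓘(ℝ, E') (extChartAt J (φ x₀) ∘ φ) x₀ := by
    apply Filter.EventuallyEq.mfderiv_eq
    filter_upwards [extChartAt_source_mem_nhds (I := I) x₀] with x hx
    simp only [writtenInExtChartAt, Function.comp_apply, (extChartAt I x₀).left_inv hx]
  rw [mfderiv_eq_fderiv] at h5
  exact DFunLike.congr_fun (h5.symm.trans (h6.trans h4)) v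

/-- The derivative of the inverse chart is the inverse of the tangent trivialization, so the chart
expression is the bundle coordinate of `β` composed with the inverse chart. -/
theorem differentiableAt_formInChart {β : Π x : M, Cotangent I x} {x₀ : M}
    (hβ : ContMDiffAt I (I.prod 𝓘(ℝ, E →L[ℝ] ℝ)) ∞
      (fun x => (TotalSpace.mk' (E →L[ℝ] ℝ) x (β x) :
        TotalSpace (E →L[ℝ] ℝ) (Cotangent I : M → Type _))) x₀) :
    DifferentiableAt ℝ (formInChart I β x₀) (extChartAt I x₀ x₀) := by
  rw [contMDiffAt_hom_bundle] at hβ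
  have h1 := hβ.2
  simp only [inCoordinates_cotangent] at h1
  have h2 : ContMDiffAt 𝓘(ℝ, E) I ∞ (extChartAt I x₀).symm (extChartAt I x₀ x₀) :=
    (contMDiffOn_extChartAt_symm x₀).contMDiffAt (extChartAt_target_mem_nhds x₀)
  have h3 := h1.comp_of_eq h2 (extChartAt_to_inv x₀)
  refine (h3.contDiffAt.differentiableAt (by simp)).congr_of_eventuallyEq ?_
  filter_upwards [extChartAt_target_mem_nhds (I := I) x₀] with u hu
  have hs := (extChartAt I x₀).map_target hu
  rw [extChartAt_source] at hs
  have h4 := TangentBundle.symmL_trivializationAt (I := I) hs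
  simp only [Function.comp_apply, formInChart, h4]
  rw [(extChartAt I x₀).right_inv hu]

theorem differentiableAt_vectorInChart [CompleteSpace E] {X : Π x : M, TangentSpace I x} {x₀ : M}
    (hX : ContMDiffAt I (I.prod 𝓘(ℝ, E)) ∞
      (fun x => (TotalSpace.mk' E x (X x) : TotalSpace E (TangentSpace I : M → Type _))) x₀) :
    DifferentiableAt ℝ (vectorInChart I X x₀) (extChartAt I x₀ x₀) := by
  -- Pulling back a field costs one derivative of the chart; `m = 1` suffices for differentiability.
  have h := VectorField.contMDiffWithinAt_mpullbackWithin_extChartAt_symm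
    (n := ∞) (m := 1) (s := univ) (contMDiffWithinAt_univ.2 (hX.of_le (by simp)))
    uniqueMDiffOn_univ (mem_univ x₀)
    (WithTop.coe_le_coe.2 (le_top : (1 + 1 : ℕ∞) ≤ ⊤))
  rw [preimage_univ, inter_univ] at h
  have h' := h.contMDiffAt (extChartAt_target_mem_nhds (I := I) x₀)
  rw [contMDiffAt_totalSpace] at h'
  refine (h'.2.contDiffAt.differentiableAt (by simp)).congr_of_eventuallyEq
    (Filter.Eventually.of_forall fun u => ?_)
  simp
  rfl

theorem mfderiv_extChartAt_mlieBracket (X₁ X₂ : Π x : M, TangentSpace I x) (x₀ : M) :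
    mfderiv I 𝓘(ℝ, E) (extChartAt I x₀) x₀ (VectorField.mlieBracket I X₁ X₂ x₀) =
      VectorField.lieBracket ℝ (vectorInChart I X₁ x₀) (vectorInChart I X₂ x₀)
        (extChartAt I x₀ x₀) := by
  have h : (VectorField.lieBracketWithin ℝ (vectorInChart I X₁ x₀) (vectorInChart I X₂ x₀)
      ((extChartAt I x₀).symm ⁻¹' univ ∩ range I)) =
      VectorField.lieBracket ℝ (vectorInChart I X₁ x₀) (vectorInChart I X₂ x₀) := by
    rw [preimage_univ, univ_inter, I.range_eq_univ, VectorField.lieBracketWithin_univ]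
  rw [← h]
  exact (isInvertible_mfderiv_extChartAt (mem_extChartAt_source x₀)).self_apply_inverse _

theorem mlieBracket_of_related [CompleteSpace E] [CompleteSpace E']
    {φ : M → N} (hφ : ContMDiff I J ∞ φ) (x₀ : M)
    {X₁ X₂ : Π x : M, TangentSpace I x} {Y₁ Y₂ : Π y : N, TangentSpace J y}
    (hX₁ : DifferentiableAt ℝ (vectorInChart I X₁ x₀) (extChartAt I x₀ x₀))
    (hX₂ : DifferentiableAt ℝ (vectorInChart I X₂ x₀) (extChartAt I x₀ x₀))
    (hY₁ : DifferentiableAt ℝ (vectorInChart J Y₁ (φ x₀)) (extChartAt J (φ x₀) (φ x₀)))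
    (hY₂ : DifferentiableAt ℝ (vectorInChart J Y₂ (φ x₀)) (extChartAt J (φ x₀) (φ x₀)))
    (h₁ : ∀ x, mfderiv I J φ x (X₁ x) = Y₁ (φ x)) (h₂ : ∀ x, mfderiv I J φ x (X₂ x) = Y₂ (φ x)) :
    mfderiv I J φ x₀ (VectorField.mlieBracket I X₁ X₂ x₀) =
      VectorField.mlieBracket J Y₁ Y₂ (φ x₀) := by
  have hf0 : writtenInExtChartAt I J x₀ φ (extChartAt I x₀ x₀) = extChartAt J (φ x₀) (φ x₀) := by
    simp [writtenInExtChartAt]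
  have key := fderiv_lieBracket_of_related
    ((contDiffAt_writtenInExtChartAt hφ x₀).of_le
      (WithTop.coe_le_coe.2 (le_top : (2 : ℕ∞) ≤ ⊤)))
    hX₁ (hf0 ▸ hY₁) hX₂ (hf0 ▸ hY₂)
    (eventually_vectorInChart_of_related hφ x₀ h₁) (eventually_vectorInChart_of_related hφ x₀ h₂)
  rw [hf0] at key
  -- The chart derivative at `φ x₀` is injective, so both brackets may be compared in the chart,
  -- where `key` applies.
  apply (isInvertible_mfderiv_extChartAt (I := J) (mem_extChartAt_source (φ x₀))).injective
  rw [mfderiv_extChartAt_mlieBracket, ← key, ← mfderiv_extChartAt_mlieBracket,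
    fderiv_writtenInExtChartAt_mfderiv hφ]

theorem lieDerivForm_of_related {φ : M → N} (hφ : ContMDiff I J ∞ φ) (x₀ : M)
    {X : Π x : M, TangentSpace I x} {Y : Π y : N, TangentSpace J y}
    {α : Π x : M, Cotangent I x} {β : Π y : N, Cotangent J y}
    (hX : DifferentiableAt ℝ (vectorInChart I X x₀) (extChartAt I x₀ x₀))
    (hY : DifferentiableAt ℝ (vectorInChart J Y (φ x₀)) (extChartAt J (φ x₀) (φ x₀)))
    (hβ : DifferentiableAt ℝ (formInChart J β (φ x₀)) (extChartAt J (φ x₀) (φ x₀)))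
    (h : ∀ x, mfderiv I J φ x (X x) = Y (φ x))
    (hα : ∀ x, α x = (β (φ x)).comp (mfderiv I J φ x)) :
    lieDerivForm I X α x₀ = (lieDerivForm J Y β (φ x₀)).comp (mfderiv I J φ x₀) := by
  have hf0 : writtenInExtChartAt I J x₀ φ (extChartAt I x₀ x₀) = extChartAt J (φ x₀) (φ x₀) := by
    simp [writtenInExtChartAt]
  have key := fderiv_lieDeriv_of_related
    ((contDiffAt_writtenInExtChartAt hφ x₀).of_le
      (WithTop.coe_le_coe.2 (le_top : (2 : ℕ∞) ≤ ⊤)))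
    hX (hf0 ▸ hY) (hf0 ▸ hβ)
    (eventually_vectorInChart_of_related hφ x₀ h) (eventually_formInChart_of_related hφ x₀ hα)
  rw [hf0] at key
  ext v
  have h1 := fderiv_writtenInExtChartAt_mfderiv hφ x₀ v
  simp only [lieDerivForm, I.range_eq_univ, J.range_eq_univ, fderivWithin_univ]
  rw [key]
  exact congrArg (fderiv ℝ (formInChart J β (φ x₀)) (extChartAt J (φ x₀) (φ x₀))
      (vectorInChart J Y (φ x₀) (extChartAt J (φ x₀) (φ x₀))) +
    (formInChart J β (φ x₀) (extChartAt J (φ x₀) (φ x₀))).comp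
      (fderiv ℝ (vectorInChart J Y (φ x₀)) (extChartAt J (φ x₀) (φ x₀)))) h1

end Charts

/-! ### Naturality of the Courant bracket -/

section Bracket

variable
    {E : Type*} [NormedAddCommGroup E] [NormedSpace ℝ E]
    {H : Type*} [TopologicalSpace H] {I : ModelWithCorners ℝ E H}
    {M : Type*} [TopologicalSpace M] [ChartedSpace H M] [IsManifold I ∞ M]
    {E' : Type*} [NormedAddCommGroup E'] [NormedSpace ℝ E']
    {H' : Type*} [TopologicalSpace H'] {J : ModelWithCorners ℝ E' H'}
    {N : Type*} [TopologicalSpace N] [ChartedSpace H' N] [IsManifold J ∞ N]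

theorem SmoothOn.contMDiffAt_fst {a : Π x : M, GenTangent I x} (ha : SmoothOn I a univ) (x : M) :
    ContMDiffAt I (I.prod 𝓘(ℝ, E)) ∞
      (fun x => (TotalSpace.mk' E x (a x).1 : TotalSpace E (TangentSpace I : M → Type _))) x :=
  ha.1.contMDiffAt Filter.univ_mem

theorem SmoothOn.contMDiffAt_snd {a : Π x : M, GenTangent I x} (ha : SmoothOn I a univ) (x : M) :
    ContMDiffAt I (I.prod 𝓘(ℝ, E →L[ℝ] ℝ)) ∞
      (fun x => (TotalSpace.mk' (E →L[ℝ] ℝ) x (a x).2 :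
        TotalSpace (E →L[ℝ] ℝ) (Cotangent I : M → Type _))) x :=
  ha.2.contMDiffAt Filter.univ_mem

theorem mdifferentiableAt_cotangent_apply {α : Π x : M, Cotangent I x}
    {X : Π x : M, TangentSpace I x} {x₀ : M}
    (hα : ContMDiffAt I (I.prod 𝓘(ℝ, E →L[ℝ] ℝ)) ∞
      (fun x => (TotalSpace.mk' (E →L[ℝ] ℝ) x (α x) :
        TotalSpace (E →L[ℝ] ℝ) (Cotangent I : M → Type _))) x₀)
    (hX : ContMDiffAt I (I.prod 𝓘(ℝ, E)) ∞
      (fun x => (TotalSpace.mk' E x (X x) : TotalSpace E (TangentSpace I : M → Type _))) x₀) :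
    MDifferentiableAt I 𝓘(ℝ, ℝ) (fun x => (α x (X x) : ℝ)) x₀ := by
  have h := ContMDiffAt.clm_bundle_apply (E₂ := Trivial M ℝ) hα hX
  rw [contMDiffAt_totalSpace] at h
  exact h.2.mdifferentiableAt (by simp)

theorem dFun_comp {φ : M → N} (hφ : ContMDiff I J ∞ φ) {g : N → ℝ} {x₀ : M}
    (hg : MDifferentiableAt J 𝓘(ℝ, ℝ) g (φ x₀)) :
    dFun I (fun x => g (φ x)) x₀ = (dFun J g (φ x₀)).comp (mfderiv I J φ x₀) :=
  mfderiv_comp x₀ hg ((hφ x₀).mdifferentiableAt (by simp))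

variable [I.Boundaryless] [J.Boundaryless] [CompleteSpace E] [CompleteSpace E']

theorem courantBracket_of_related {φ : M → N} (hφ : ContMDiff I J ∞ φ)
    {a b : Π x : M, GenTangent I x} {a' b' : Π y : N, GenTangent J y}
    (ha : SmoothOn I a univ) (hb : SmoothOn I b univ)
    (ha' : SmoothOn J a' univ) (hb' : SmoothOn J b' univ)
    (ha₁ : ∀ x, mfderiv I J φ x (a x).1 = (a' (φ x)).1)
    (ha₂ : ∀ x, (a x).2 = (a' (φ x)).2.comp (mfderiv I J φ x))
    (hb₁ : ∀ x, mfderiv I J φ x (b x).1 = (b' (φ x)).1)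
    (hb₂ : ∀ x, (b x).2 = (b' (φ x)).2.comp (mfderiv I J φ x)) (x₀ : M) :
    mfderiv I J φ x₀ (courantBracket I a b x₀).1 = (courantBracket J a' b' (φ x₀)).1 ∧
      (courantBracket I a b x₀).2 =
        (courantBracket J a' b' (φ x₀)).2.comp (mfderiv I J φ x₀) := by
  have hX := differentiableAt_vectorInChart (ha.contMDiffAt_fst x₀)
  have hY := differentiableAt_vectorInChart (hb.contMDiffAt_fst x₀)
  have hX' := differentiableAt_vectorInChart (ha'.contMDiffAt_fst (φ x₀))
  have hY' := differentiableAt_vectorInChart (hb'.contMDiffAt_fst (φ x₀))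
  have hα := differentiableAt_formInChart (ha'.contMDiffAt_snd (φ x₀))
  have hβ := differentiableAt_formInChart (hb'.contMDiffAt_snd (φ x₀))
  refine ⟨mlieBracket_of_related hφ x₀ hX hY hX' hY' ha₁ hb₁, ?_⟩
  -- Contractions of related forms and vectors are pullbacks of functions on `N`, so the exact term
  -- reduces to the chain rule.
  have hg : (fun x => ((a x).2 (b x).1 : ℝ) - ((b x).2 (a x).1 : ℝ)) =
      fun x => ((a' (φ x)).2 (b' (φ x)).1 : ℝ) - ((b' (φ x)).2 (a' (φ x)).1 : ℝ) := by
    funext x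
    rw [ha₂, hb₂, ← ha₁, ← hb₁]
    rfl
  have hd : MDifferentiableAt J 𝓘(ℝ, ℝ)
      (fun y => ((a' y).2 (b' y).1 : ℝ) - ((b' y).2 (a' y).1 : ℝ)) (φ x₀) :=
    (mdifferentiableAt_cotangent_apply (ha'.contMDiffAt_snd _) (hb'.contMDiffAt_fst _)).sub
      (mdifferentiableAt_cotangent_apply (hb'.contMDiffAt_snd _) (ha'.contMDiffAt_fst _))
  have h₁ := lieDerivForm_of_related hφ x₀ hX hX' hβ ha₁ hb₂
  have h₂ := lieDerivForm_of_related hφ x₀ hY hY' hα hb₁ ha₂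
  have h₃ := dFun_comp hφ hd
  simp only [courantBracket]
  rw [h₁, h₂, hg, h₃]
  rfl

end Bracket

/-! ### Linear algebra in the fibres -/

section Pointwise

variable
    {E : Type*} [NormedAddCommGroup E] [NormedSpace ℝ E]
    {H : Type*} [TopologicalSpace H] {I : ModelWithCorners ℝ E H}
    {M : Type*} [TopologicalSpace M] [ChartedSpace H M] [IsManifold I ∞ M]
    {E' : Type*} [NormedAddCommGroup E'] [NormedSpace ℝ E'] [FiniteDimensional ℝ E']
    {H' : Type*} [TopologicalSpace H'] {J : ModelWithCorners ℝ E' H'}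
    {N : Type*} [TopologicalSpace N] [ChartedSpace H' N] [IsManifold J ∞ N]
    {L : DiracStructure I M} {K : DiracStructure J N} {φ : M → N}

theorem exists_leftInverse_mfderiv {x : M} (h : Function.Injective (mfderiv I J φ x)) :
    ∃ P : TangentSpace J (φ x) →L[ℝ] TangentSpace I x,
      ∀ v, P (mfderiv I J φ x v) = v := by
  obtain ⟨P, hP⟩ :=
    (show E →L[ℝ] E' from mfderiv I J φ x).toLinearMap.exists_leftInverse_of_injective
      (LinearMap.ker_eq_bot.2 h)
  exact ⟨(LinearMap.toContinuousLinearMap P : E' →L[ℝ] E), fun v => LinearMap.congr_fun hP v⟩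

theorem IsFDirac.isBDirac (hf : IsFDirac φ L K)
    (hinj : ∀ x, Function.Injective (mfderiv I J φ x)) : IsBDirac φ L K := by
  refine ⟨hf.1, fun x => Subset.antisymm ?_ ?_⟩
  · rintro ⟨X, ξ⟩ hp
    obtain ⟨P, hP⟩ := exists_leftInverse_mfderiv (hinj x)
    -- Injectivity of `φ_*` makes its transpose surjective: `ξ ∘ P` extends `ξ` to a covector on
    -- `N`.
    have hξ : ξ = (ContinuousLinearMap.comp ξ P).comp (mfderiv I J φ x) := by
      ext v
      exact congrArg ξ (hP v).symm
    refine ⟨X, ContinuousLinearMap.comp ξ P, ?_, Prod.ext rfl hξ⟩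
    rw [← SetLike.mem_coe, hf.2 x]
    exact ⟨X, ContinuousLinearMap.comp ξ P, by rw [← hξ]; exact hp, rfl⟩
  · rintro _ ⟨X, α, hK, rfl⟩
    rw [← SetLike.mem_coe, hf.2 x] at hK
    obtain ⟨X', α', hL, he⟩ := hK
    obtain ⟨h₁, rfl⟩ := Prod.ext_iff.1 he
    obtain rfl := hinj x h₁
    exact hL

theorem IsFDirac.exists_pullback (hf : IsFDirac φ L K)
    (hinj : ∀ x, Function.Injective (mfderiv I J φ x)) (x : M) :
    ∃ T : K.fiber (φ x) →ₗ[ℝ] L.fiber x, ∀ q,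
      mfderiv I J φ x (T q).1.1 = q.1.1 ∧ (T q).1.2 = q.1.2.comp (mfderiv I J φ x) := by
  obtain ⟨P, hP⟩ := exists_leftInverse_mfderiv (hinj x)
  have key : ∀ q ∈ K.fiber (φ x), mfderiv I J φ x (P q.1) = q.1 ∧
      ((P q.1, q.2.comp (mfderiv I J φ x)) : GenTangent I x) ∈ L.fiber x := by
    intro q hq
    rw [← SetLike.mem_coe, hf.2 x] at hq
    obtain ⟨X, α, hL, rfl⟩ := hq
    simp only [hP]
    exact ⟨trivial, hL⟩
  -- Using `P` on the whole fibre makes linearity immediate. On `K` the vector part lies in the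
  -- image of `φ_*`, so there `P` is the true inverse and the choice of `P` is immaterial.
  let T₀ : GenTangent J (φ x) →ₗ[ℝ] GenTangent I x :=
    { toFun := fun q => (P q.1, q.2.comp (mfderiv I J φ x))
      map_add' := fun p q => Prod.ext (map_add P _ _) (ContinuousLinearMap.add_comp _ _ _)
      map_smul' := fun c p => Prod.ext (map_smul P _ _) (ContinuousLinearMap.smul_comp _ _ _) }
  exact ⟨T₀.restrict fun q hq => (key q hq).2, fun q => ⟨(key q.1 q.2).1, rfl⟩⟩

end Pointwise
end DiracGeom

/-! ### Assembly of the comorphism -/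

theorem mainTheorem9
    {E : Type*} [NormedAddCommGroup E] [NormedSpace ℝ E] [FiniteDimensional ℝ E]
    {H : Type*} [TopologicalSpace H] {I : ModelWithCorners ℝ E H} [I.Boundaryless]
    {M : Type*} [TopologicalSpace M] [ChartedSpace H M] [IsManifold I ∞ M]
    [T2Space M] [SecondCountableTopology M]
    {E' : Type*} [NormedAddCommGroup E'] [NormedSpace ℝ E'] [FiniteDimensional ℝ E']
    {H' : Type*} [TopologicalSpace H'] {J : ModelWithCorners ℝ E' H'} [J.Boundaryless]
    {N : Type*} [TopologicalSpace N] [ChartedSpace H' N] [IsManifold J ∞ N]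
    [T2Space N] [SecondCountableTopology N]
    (L : DiracGeom.DiracStructure I M) (K : DiracGeom.DiracStructure J N) (φ : M → N)
    (hf : DiracGeom.IsFDirac φ L K) (himm : DiracGeom.IsSmoothImmersion I J φ) :
    DiracGeom.IsBDirac φ L K ∧
      ∃ Φ : DiracGeom.PullbackBundleMap φ L K,
        (∀ (x : M) (q : K.fiber (φ x)),
          mfderiv I J φ x (Φ.toFun x q).1.1 = q.1.1 ∧
            (Φ.toFun x q).1.2 = q.1.2.comp (mfderiv I J φ x)) ∧
        Φ.IsComorphism himm.1 := by
  refine ⟨hf.isBDirac himm.2, ?_⟩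
  choose T hT using hf.exists_pullback himm.2
  let Φ : DiracGeom.PullbackBundleMap φ L K :=
    { toFun := T
      smooth := fun U hU s hs => by
        constructor
        · intro x hx
          refine (DiracGeom.contMDiffAt_of_mfderiv_apply himm.1 (himm.2 x) ?_).contMDiffWithinAt
          simp only [fun x => (hT x (s x)).1]
          exact hs.1.contMDiffAt (hU.mem_nhds hx)
        · intro x hx
          simp only [fun x => (hT x (s x)).2]
          exact (DiracGeom.contMDiffAt_cotangent_comp_mfderiv himm.1
            (hs.2.contMDiffAt (hU.mem_nhds hx))).contMDiffWithinAt }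
  refine ⟨Φ, hT, ⟨fun a b => ?_, fun a x => (hT x _).1⟩⟩
  have := FiniteDimensional.complete ℝ E
  have := FiniteDimensional.complete ℝ E'
  apply Subtype.ext
  funext x
  obtain ⟨h₁, h₂⟩ := DiracGeom.courantBracket_of_related himm.1
    (Φ.onSections himm.1 a).2.1 (Φ.onSections himm.1 b).2.1 a.2.1 b.2.1
    (fun x => (hT x _).1) (fun x => (hT x _).2) (fun x => (hT x _).1) (fun x => (hT x _).2) x
  obtain ⟨h₃, h₄⟩ := hT x ((K.bracket a b).eval (φ x))
  -- The vector parts have the same image under the injective `φ_*`; the form parts are pullbacks of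
  -- the same covector.
  exact Prod.ext (himm.2 x (h₁.trans h₃.symm)) (h₂.trans h₄.symm)
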